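/- Let $(\lambda_n)_{n\ge1}$ be a sequence of real numbers with $\lambda_1>0$ and $\lambda_n\ge 0$ for all $n\ge 2$, and put $\Lambda_n:=\lambda_1+\cdots+\lambda_n$. Assume that $\Lambda_n\to\infty$ and that the sequence $(\lambda_n/\Lambda_n)_{n\ge1}$ is nonincreasing with limit $\eta\in[0,1)$. Let $f\colon(0,\infty)\to\mathbb R$ be a twice continuously differentiable function with nowhere vanishing first derivative, and let $$\chi_f(x):=\frac{x f''(x)}{f'(x)}+1\qquad(x>0).$$ Assume that the limit $p:=\lim_{x\to0^+}\chi_f(x)$ exists, that $p<1$, and that $\chi_f(x)\le p$ for all $x>0$. For $x_1,\dots,x_n>0$ and weights $w_1,\dots,w_n\ge0$ with $w_1+\cdots+w_n>0$, let $$\mathrm{QA}_f\big((x_1,\dots,x_n),(w_1,\dots,w_n)\big):=f^{-1}\left(\frac{w_1f(x_1)+\cdots+w_nf(x_n)}{w_1+\cdots+w_n}\right)$$ be the weighted quasiarithmetic mean generated by $f$. Then the $\lambda$-Hardy constant of $\mathrm{QA}_f$, i.e. the smallest extended real number $H$ such that $$\sum_{n=1}^\infty\lambda_n\,\mathrm{QA}_f\big((x_1,\dots,x_n),(\lambda_1,\dots,\lambda_n)\big)\le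 H\sum_{n=1}^\infty\lambda_nx_n\qquad\text{for all sequences }(x_n)_{n\ge1}\text{ in }(0,\infty),$$ equals $C(p,\eta)$, where, for $r<1$ and $\eta\in[0,1)$, $$C(r,\eta):=\begin{cases}\left(\dfrac{\eta}{1-(1-\eta)^{1-r}}\right)^{1/r}, & \eta\in(0,1),\ r\ne0,\\[3mm](1-\eta)^{1-1/\eta}, & \eta\in(0,1),\ r=0,\\[1mm](1-r)^{-1/r}, & \eta=0,\ r\ne0,\\[1mm] e, & \eta=0,\ r=0.\end{cases}$$ -/

import Mathlib

open Filter Topology Set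

noncomputable section

/-- Partial sums of a weight sequence; sequences are indexed from `0`, so `partialWeight lam n` is
the sum of the first `n + 1` weights. -/
def partialWeight (lam : ℕ → ℝ) (n : ℕ) : ℝ :=
  ∑ i ∈ Finset.range (n + 1), lam i

/-- The weighted quasiarithmetic mean on `I` generated by `f`: the element `y` of `I` with
`f y = (w₁ f(x₁) + ⋯ + wₙ f(xₙ)) / (w₁ + ⋯ + wₙ)`. For an interval `I`, `f` continuous and
injective on `I`, points in `I` and nonnegative weights with positive sum, such a `y` exists and
is unique. -/
def quasiArithmeticMean (I : Set ℝ) (f : ℝ → ℝ) (n : ℕ) (x w : Fin n → ℝ) : ℝ :=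
  Function.invFunOn f I ((∑ i, w i * f (x i)) / ∑ i, w i)

/-- The constants `C ∈ [0, ∞]` such that
`∑ λₙ M((x₁,…,xₙ),(λ₁,…,λₙ)) ≤ C ∑ λₙ xₙ` for all sequences in `I`. It is used for
`I ⊆ (0, ∞)`, nonnegative weights and means with values in `I`, so that all terms of the two
series are nonnegative and the sums are taken in `[0, ∞]`. -/
def hardyBounds (I : Set ℝ) (M : (n : ℕ) → (Fin n → ℝ) → (Fin n → ℝ) → ℝ) (lam : ℕ → ℝ) :
    Set ENNReal :=
  {C | ∀ x : ℕ → ℝ, (∀ n, x n ∈ I) →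
    ∑' n : ℕ, ENNReal.ofReal
        (lam n * M (n + 1) (fun i : Fin (n + 1) => x i) (fun i : Fin (n + 1) => lam i)) ≤
      C * ∑' n : ℕ, ENNReal.ofReal (lam n * x n)}

/-- `C` is the `lam`-weighted Hardy constant of `M` on `I`: the smallest `C` for which the Hardy
inequality holds. -/
def IsHardyConstant (I : Set ℝ) (M : (n : ℕ) → (Fin n → ℝ) → (Fin n → ℝ) → ℝ) (lam : ℕ → ℝ)
    (C : ENNReal) : Prop :=
  IsLeast (hardyBounds I M lam) C

/-- The function `χ_f(x) = x f''(x) / f'(x) + 1`. -/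
def chi (f : ℝ → ℝ) (x : ℝ) : ℝ :=
  x * deriv (deriv f) x / deriv f x + 1

/-- The constant `C(r, η)`, used for `r < 1` and `0 ≤ η < 1`. -/
def hardyC (r η : ℝ) : ℝ :=
  if η = 0 then
    if r = 0 then Real.exp 1 else (1 - r) ^ (-1 / r)
  else
    if r = 0 then (1 - η) ^ (1 - 1 / η) else (η / (1 - (1 - η) ^ (1 - r))) ^ (1 / r)

end

/-! Put g = `powGen p` and v = 1/(1-η), and let R be the chord slope of g over [1, v], or g'(1) if η
= 0. The constant C = `hardyC p η` solves g(1/C) = -R (`powGen_inv_hardyC`).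

Upper bound: let F = ±f, the sign making F increasing. As χ_f ≤ p, F'(x) x^(1-p) is nonincreasing,
so at each point a multiple of g, up to a constant, touches F from above. Each mean M_n is a
two-point mean of x_n and M_{n-1}, so one step reduces to g. Tangents to the concave g at 1/C and v
make it linear (`two_point_mean_le`), and the steps telescope with remainder K Λ_n M_n
(`sum_mean_add_le`).

Lower bound: test x_n = 1/Λ_n. As χ_f → p at 0, F'(x) x^(1-p) varies slowly there, so F behaves like
a multiple of g on comparable scales, and the means eventually reach c/Λ_n whenever 1 < c < C
(`eventually_le_mean`). Since ∑ λ_n/Λ_n diverges, a truncation of this sequence refutes any H < C.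
-/

/-! ### Power generators and comparison with them -/

/-- The normalized generator of the `p`-th power mean, a primitive of `x ↦ x ^ (p - 1)`. -/
noncomputable def powGen (p x : ℝ) : ℝ :=
  if p = 0 then Real.log x else (x ^ p - 1) / p

theorem powGen_one (p : ℝ) : powGen p 1 = 0 := by
  unfold powGen; split_ifs <;> simp

theorem hasDerivAt_powGen (p : ℝ) {x : ℝ} (hx : 0 < x) :
    HasDerivAt (powGen p) (x ^ (p - 1)) x := by
  unfold powGen
  split_ifs with h
  · subst h
    simpa [Real.rpow_neg_one] using Real.hasDerivAt_log hx.ne'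
  · have := ((Real.hasDerivAt_rpow_const (p := p) (Or.inl hx.ne')).sub_const 1).div_const p
    rwa [mul_div_cancel_left₀ _ h] at this

theorem powGen_mul (p : ℝ) {x z : ℝ} (hx : 0 < x) (hz : 0 < z) :
    powGen p (z * x) = powGen p z + z ^ p * powGen p x := by
  unfold powGen
  split_ifs with h
  · subst h; simp [Real.log_mul hz.ne' hx.ne']
  · rw [Real.mul_rpow hz.le hx.le]; field_simp; ring

theorem powGen_sub {p x z : ℝ} (hx : 0 < x) (hz : 0 < z) :
    powGen p x - powGen p z = z ^ p * powGen p (x / z) := by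
  have h := powGen_mul p (div_pos hx hz) hz
  rw [mul_div_cancel₀ _ hz.ne'] at h
  linarith

/-- If `F' ≥ k g'` on `[a, b]` then `F b - F a ≥ k (g b - g a)`, where `g = powGen p`. -/
theorem mul_powGen_sub_le {F F' : ℝ → ℝ} {p k a b : ℝ}
    (hF : ∀ x, 0 < x → HasDerivAt F (F' x) x) (ha : 0 < a) (hab : a ≤ b)
    (hk : ∀ u ∈ Icc a b, k * u ^ (p - 1) ≤ F' u) :
    k * (powGen p b - powGen p a) ≤ F b - F a := by
  have hd : ∀ x ∈ Icc a b,
      HasDerivAt (fun x => F x - k * powGen p x) (F' x - k * x ^ (p - 1)) x := fun x hx =>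
    (hF x (ha.trans_le hx.1)).sub ((hasDerivAt_powGen p (ha.trans_le hx.1)).const_mul k)
  have hm : MonotoneOn (fun x => F x - k * powGen p x) (Icc a b) := by
    refine monotoneOn_of_deriv_nonneg (convex_Icc a b)
      (fun x hx => (hd x hx).continuousAt.continuousWithinAt)
      (fun x hx => (hd x (interior_subset hx)).differentiableAt.differentiableWithinAt) ?_
    intro x hx
    rw [(hd x (interior_subset hx)).deriv]
    exact sub_nonneg.2 (hk x (interior_subset hx))
  have := hm (left_mem_Icc.2 hab) (right_mem_Icc.2 hab) hab
  simp only at this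
  linarith

/-- If `F' ≤ k g'` on `[a, b]` then `F b - F a ≤ k (g b - g a)`, where `g = powGen p`. -/
theorem sub_le_mul_powGen_sub {F F' : ℝ → ℝ} {p k a b : ℝ}
    (hF : ∀ x, 0 < x → HasDerivAt F (F' x) x) (ha : 0 < a) (hab : a ≤ b)
    (hk : ∀ u ∈ Icc a b, F' u ≤ k * u ^ (p - 1)) :
    F b - F a ≤ k * (powGen p b - powGen p a) := by
  have := mul_powGen_sub_le (F := fun x => -F x) (F' := fun x => -F' x) (p := p) (k := -k)
    (fun x hx => (hF x hx).neg) ha hab (fun u hu => by have := hk u hu; linarith)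
  linarith

theorem mul_rpow_self_sub_one {p u : ℝ} (a : ℝ) (hu : 0 < u) :
    a * u ^ (1 - p) * u ^ (p - 1) = a := by
  rw [mul_assoc, ← Real.rpow_add hu]; simp

/-- A generator whose derivative grows more slowly than that of `powGen p` lies below a multiple
of `powGen p` that touches it at a given point. -/
theorem sub_le_touching {F F' : ℝ → ℝ} {p x z : ℝ}
    (hF : ∀ x, 0 < x → HasDerivAt F (F' x) x)
    (hφ : AntitoneOn (fun x => F' x * x ^ (1 - p)) (Ioi 0)) (hx : 0 < x) (hz : 0 < z) :
    F x - F z ≤ F' z * z ^ (1 - p) * (powGen p x - powGen p z) := by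
  rcases le_total z x with h | h
  · refine sub_le_mul_powGen_sub hF hz h fun u hu => ?_
    have hu0 : 0 < u := hz.trans_le hu.1
    have := mul_le_mul_of_nonneg_right (hφ (mem_Ioi.2 hz) (mem_Ioi.2 hu0) hu.1)
      (Real.rpow_nonneg hu0.le (p - 1))
    simpa only [mul_rpow_self_sub_one _ hu0] using this
  · have := mul_powGen_sub_le (p := p) (k := F' z * z ^ (1 - p)) hF hx h fun u hu => by
      have hu0 : 0 < u := hx.trans_le hu.1
      have := mul_le_mul_of_nonneg_right (hφ (mem_Ioi.2 hu0) (mem_Ioi.2 hz) hu.2)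
        (Real.rpow_nonneg hu0.le (p - 1))
      simpa only [mul_rpow_self_sub_one _ hu0] using this
    linarith

/-- `powGen p` lies below its tangents for `p ≤ 1`. -/
theorem powGen_le_tangent {p x u : ℝ} (hp : p ≤ 1) (hx : 0 < x) (hu : 0 < u) :
    powGen p x ≤ powGen p u + u ^ (p - 1) * (x - u) := by
  -- `powGen 1` is affine, so touching from above with exponent 1 is the tangent inequality.
  have h := sub_le_touching (p := 1) (F := powGen p) (F' := fun x => x ^ (p - 1))
    (fun x hx => hasDerivAt_powGen p hx) (by
      intro a ha b hb hab
      simpa using Real.rpow_le_rpow_of_nonpos ha hab (by linarith : p - 1 ≤ 0)) hx hu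
  have h1 : ∀ t : ℝ, powGen 1 t = t - 1 := fun t => by simp [powGen]
  simp only [h1, sub_self, Real.rpow_zero, mul_one] at h
  linarith

theorem powGen_lt_powGen {p x y : ℝ} (hx : 0 < x) (hxy : x < y) : powGen p x < powGen p y := by
  have hm : StrictMonoOn (powGen p) (Ioi 0) := by
    refine strictMonoOn_of_deriv_pos (convex_Ioi 0)
      (fun x hx => (hasDerivAt_powGen p hx).continuousAt.continuousWithinAt) ?_
    intro x hx
    rw [interior_Ioi] at hx
    rw [(hasDerivAt_powGen p hx).deriv]
    exact Real.rpow_pos_of_pos hx _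
  exact hm (mem_Ioi.2 hx) (mem_Ioi.2 (hx.trans hxy)) hxy

/-- `dslope` merges chord slope and derivative, so η = 0 needs no separate treatment in the
estimates. -/
theorem sub_one_mul_dslope (p v : ℝ) : (v - 1) * dslope (powGen p) 1 v = powGen p v := by
  have := sub_smul_dslope (powGen p) 1 v
  simpa [powGen_one] using this

theorem continuousAt_dslope_powGen (p : ℝ) {v : ℝ} (hv : 0 < v) :
    ContinuousAt (dslope (powGen p) 1) v := by
  by_cases h : v = 1
  · subst h
    exact continuousAt_dslope_same.2 (hasDerivAt_powGen p hv).differentiableAt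
  · exact (continuousAt_dslope_of_ne h).2 (hasDerivAt_powGen p hv).continuousAt

/-- By concavity, the slope at the right end is at most that of the chord. -/
theorem rpow_sub_one_le_dslope {p v : ℝ} (hp : p ≤ 1) (hv : 1 ≤ v) :
    v ^ (p - 1) ≤ dslope (powGen p) 1 v := by
  rcases hv.eq_or_lt with rfl | h
  · rw [dslope_same, (hasDerivAt_powGen p one_pos).deriv]
  · have h1 := powGen_le_tangent hp one_pos (one_pos.trans h)
    rw [powGen_one, ← sub_one_mul_dslope p v] at h1
    have : 0 < v - 1 := by linarith
    by_contra hc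
    push Not at hc
    nlinarith

/-! ### The constant C(p, η) -/

theorem hardyC_pos {p η : ℝ} (hp : p < 1) (hη : η ∈ Ico (0 : ℝ) 1) : 0 < hardyC p η := by
  have h1 : 0 < 1 - η := by linarith [hη.2]
  unfold hardyC
  split_ifs with h0 hp0 hp0
  · exact Real.exp_pos 1
  · exact Real.rpow_pos_of_pos (by linarith) _
  · exact Real.rpow_pos_of_pos h1 _
  · have : 0 < η := lt_of_le_of_ne hη.1 (Ne.symm h0)
    have := Real.rpow_lt_one h1.le (by linarith) (by linarith : 0 < 1 - p)
    exact Real.rpow_pos_of_pos (div_pos ‹_› (by linarith)) _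

/-- The equation characterizing the constant `hardyC p η`. -/
theorem powGen_inv_hardyC {p η : ℝ} (hp : p < 1) (hη : η ∈ Ico (0 : ℝ) 1) :
    powGen p (hardyC p η)⁻¹ = -dslope (powGen p) 1 (1 - η)⁻¹ := by
  have hC := hardyC_pos hp hη
  have h1 : 0 < 1 - η := by linarith [hη.2]
  by_cases h0 : η = 0
  · subst h0
    rw [sub_zero, inv_one, dslope_same, (hasDerivAt_powGen p one_pos).deriv, Real.one_rpow]
    by_cases hp0 : p = 0
    · simp [powGen, hardyC, hp0]
    · have : 0 < 1 - p := by linarith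
      simp only [powGen, hardyC, hp0, if_true, if_false]
      rw [Real.inv_rpow (Real.rpow_nonneg this.le _), ← Real.rpow_mul this.le,
        div_mul_cancel₀ _ hp0, Real.rpow_neg_one, inv_inv]
      field_simp; ring
  · have hη0 : 0 < η := lt_of_le_of_ne hη.1 (Ne.symm h0)
    have hv : (1 - η)⁻¹ - 1 = η * (1 - η)⁻¹ := by field_simp; ring
    have hs := sub_one_mul_dslope p (1 - η)⁻¹
    rw [hv] at hs
    have hs' : dslope (powGen p) 1 (1 - η)⁻¹ = powGen p (1 - η)⁻¹ * ((1 - η) / η) := by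
      rw [← hs]; field_simp
    rw [hs']
    by_cases hp0 : p = 0
    · simp only [powGen, hardyC, hp0, if_true, h0, if_false, Real.log_inv, Real.log_rpow h1]
      field_simp; ring
    · have hθ := Real.rpow_lt_one h1.le (by linarith) (by linarith : 0 < 1 - p)
      have hb : 0 < η / (1 - (1 - η) ^ (1 - p)) := div_pos hη0 (by linarith)
      simp only [powGen, hardyC, hp0, h0, if_false]
      rw [Real.inv_rpow (Real.rpow_nonneg hb.le _), ← Real.rpow_mul hb.le,
        div_mul_cancel₀ _ hp0, Real.rpow_one, inv_div, Real.inv_rpow h1.le,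
        Real.rpow_sub h1, Real.rpow_one]
      have := Real.rpow_pos_of_pos h1 p
      field_simp; ring

/-- The right side of `powGen_inv_hardyC` is negative, while `powGen p` is nonnegative on [1, ∞). -/
theorem one_lt_hardyC {p η : ℝ} (hp : p < 1) (hη : η ∈ Ico (0 : ℝ) 1) : 1 < hardyC p η := by
  have hC := hardyC_pos hp hη
  have h1 : 0 < 1 - η := by linarith [hη.2]
  have hv : 1 ≤ (1 - η)⁻¹ := (one_le_inv₀ h1).2 (by linarith [hη.1])
  by_contra hc
  push Not at hc
  have h2 := powGen_inv_hardyC hp hη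
  have h3 := rpow_sub_one_le_dslope hp.le hv
  have h4 : 0 < (1 - η)⁻¹ ^ (p - 1) := Real.rpow_pos_of_pos (inv_pos.2 h1) _
  have h5 : 1 ≤ (hardyC p η)⁻¹ := (one_le_inv₀ hC).2 hc
  rcases h5.eq_or_lt with h | h
  · rw [← h, powGen_one] at h2; linarith
  · have := powGen_lt_powGen (p := p) one_pos h
    rw [powGen_one] at this; linarith

/-! ### Upper bound -/

/-- One step of the Hardy inequality for a two-point quasiarithmetic mean. -/
theorem two_point_mean_le {F F' : ℝ → ℝ} {p η r x y z : ℝ} (hp : p < 1)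
    (hη : η ∈ Ico (0 : ℝ) 1)
    (hF : ∀ x, 0 < x → HasDerivAt F (F' x) x) (hF' : ∀ x, 0 < x → 0 < F' x)
    (hφ : AntitoneOn (fun x => F' x * x ^ (1 - p)) (Ioi 0))
    (hx : 0 < x) (hy : 0 < y) (hz : 0 < z) (hηr : η ≤ r) (hr : r ≤ 1)
    (hmean : F z = r * F x + (1 - r) * F y) :
    (r + hardyC p η ^ p * (1 - η)⁻¹ ^ (p - 1)) * z ≤
      hardyC p η * (r * x) + hardyC p η ^ p * (1 - η)⁻¹ ^ (p - 1) * ((1 - r) * y) := by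
  have hC := hardyC_pos hp hη
  have h1 : 0 < 1 - η := by linarith [hη.2]
  have hr0 : 0 ≤ r := hη.1.trans hηr
  have hgC := powGen_inv_hardyC hp hη
  have hv0 : 0 < (1 - η)⁻¹ := inv_pos.2 h1
  have hR := rpow_sub_one_le_dslope hp.le
    ((one_le_inv₀ h1).2 (by linarith [hη.1]) : 1 ≤ (1 - η)⁻¹)
  have hgv := sub_one_mul_dslope p (1 - η)⁻¹
  have hv1 : (1 - η)⁻¹ * (1 - η) = 1 := inv_mul_cancel₀ h1.ne'
  -- The factor C^p turns the tangent slope at 1/C into the required coefficient C of x.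
  have hWA : hardyC p η ^ p * (hardyC p η)⁻¹ ^ (p - 1) = hardyC p η := by
    rw [Real.inv_rpow hC.le, ← Real.rpow_neg hC.le, ← Real.rpow_add hC]
    simp
  have hW := Real.rpow_pos_of_pos hC p
  have hkz : 0 < F' z * z ^ (1 - p) * z ^ p :=
    mul_pos (mul_pos (hF' z hz) (Real.rpow_pos_of_pos hz _)) (Real.rpow_pos_of_pos hz _)
  have hFx := sub_le_touching hF hφ hx hz
  have hFy := sub_le_touching hF hφ hy hz
  -- The tangent points are the ratios x/z and y/z in the asymptotically extremal case x_n = 1/Λ_n,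
  -- M_n ≈ C/Λ_n.
  have tX := powGen_le_tangent hp.le (div_pos hx hz) (inv_pos.2 hC)
  have tY := powGen_le_tangent hp.le (div_pos hy hz) hv0
  rw [powGen_sub hx hz, ← mul_assoc] at hFx
  rw [powGen_sub hy hz, ← mul_assoc] at hFy
  rw [hgC] at tX
  rw [← hgv] at tY
  have hxz : x = z * (x / z) := by field_simp
  have hyz : y = z * (y / z) := by field_simp
  generalize x / z = X at *
  generalize y / z = Y at *
  generalize dslope (powGen p) 1 (1 - η)⁻¹ = R at *
  generalize (1 - η)⁻¹ = v at *
  have hCi : (hardyC p η) * (hardyC p η)⁻¹ = 1 := mul_inv_cancel₀ hC.ne'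
  generalize (hardyC p η)⁻¹ = u at *
  generalize hardyC p η ^ p = W at *
  generalize hardyC p η = C at *
  generalize v ^ (p - 1) = Q at *
  generalize u ^ (p - 1) = A at *
  have hnn : 0 ≤ r * powGen p X + (1 - r) * powGen p Y := by
    refine nonneg_of_mul_nonneg_right ?_ hkz
    have e1 := mul_le_mul_of_nonneg_left hFx hr0
    have e2 := mul_le_mul_of_nonneg_left hFy (sub_nonneg.2 hr)
    linarith
  have e3 := mul_le_mul_of_nonneg_left tX hr0
  have e4 := mul_le_mul_of_nonneg_left tY (sub_nonneg.2 hr)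
  have e5 : 0 ≤ W * (r * (-R + A * (X - u)) + (1 - r) * ((v - 1) * R + Q * (Y - v))) :=
    mul_nonneg hW.le (by linarith)
  -- The slack for r ≥ η; it vanishes at r = η.
  have e6 : 0 ≤ W * (v * (r - η) * (R - Q)) :=
    mul_nonneg hW.le (mul_nonneg (mul_nonneg hv0.le (by linarith)) (by linarith))
  have e7 : r + W * Q ≤ C * (r * X) + W * Q * ((1 - r) * Y) := by
    have i1 : W * (r * (-R + A * (X - u)) + (1 - r) * ((v - 1) * R + Q * (Y - v))) +
        W * (v * (r - η) * (R - Q)) =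
        C * (r * X) + W * Q * ((1 - r) * Y) - (r + W * Q) := by
      linear_combination (r * X - r * u) * hWA - r * hCi + (W * R - W * Q) * hv1
    linarith
  rw [hxz, hyz]
  have := mul_le_mul_of_nonneg_right e7 hz.le
  linarith

theorem partialWeight_succ (lam : ℕ → ℝ) (n : ℕ) :
    partialWeight lam (n + 1) = partialWeight lam n + lam (n + 1) :=
  Finset.sum_range_succ _ _

theorem partialWeight_pos {lam : ℕ → ℝ} (hlam0 : 0 < lam 0) (hlam : ∀ n, 0 ≤ lam n) (n : ℕ) :
    0 < partialWeight lam n :=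
  hlam0.trans_le (Finset.single_le_sum (f := lam) (fun i _ => hlam i) (by simp))

theorem lam_div_partialWeight_le_one {lam : ℕ → ℝ} (hlam0 : 0 < lam 0) (hlam : ∀ n, 0 ≤ lam n)
    (n : ℕ) : lam n / partialWeight lam n ≤ 1 :=
  div_le_one_of_le₀ (Finset.single_le_sum (f := lam) (fun i _ => hlam i) (by simp))
    (partialWeight_pos hlam0 hlam n).le

/-- The finite Hardy inequality, with the remainder term that makes the induction work. -/
theorem sum_mean_add_le {lam : ℕ → ℝ} (hlam0 : 0 < lam 0) (hlam : ∀ n, 0 ≤ lam n)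
    {F F' : ℝ → ℝ} {p η : ℝ} (hp : p < 1) (hη : η ∈ Ico (0 : ℝ) 1)
    (hηr : ∀ n, η ≤ lam n / partialWeight lam n)
    (hF : ∀ x, 0 < x → HasDerivAt F (F' x) x) (hF' : ∀ x, 0 < x → 0 < F' x)
    (hφ : AntitoneOn (fun x => F' x * x ^ (1 - p)) (Ioi 0))
    {x M : ℕ → ℝ} (hx : ∀ n, 0 < x n) (hM : ∀ n, 0 < M n)
    (hmean : ∀ n, partialWeight lam n * F (M n) = ∑ i ∈ Finset.range (n + 1), lam i * F (x i))
    (n : ℕ) :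
    ∑ i ∈ Finset.range (n + 1), lam i * M i +
        hardyC p η ^ p * (1 - η)⁻¹ ^ (p - 1) * (partialWeight lam n * M n) ≤
      hardyC p η * ∑ i ∈ Finset.range (n + 1), lam i * x i := by
  have hr1 := lam_div_partialWeight_le_one hlam0 hlam
  induction n with
  | zero =>
    have h0 : partialWeight lam 0 = lam 0 := by simp [partialWeight]
    have hm := hmean 0
    rw [h0] at hm
    simp only [zero_add, Finset.sum_range_one] at hm ⊢
    -- Here r = 1, so the second point is a dummy of weight 0.
    have := two_point_mean_le hp hη hF hF' hφ (hx 0) (hx 0) (hM 0) hη.2.le le_rfl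
      (by rw [mul_left_cancel₀ hlam0.ne' hm]; ring)
    have := mul_le_mul_of_nonneg_left this hlam0.le
    rw [h0]
    linarith
  | succ n ih =>
    have hL := partialWeight_pos hlam0 hlam (n + 1)
    have e : partialWeight lam (n + 1) * (lam (n + 1) / partialWeight lam (n + 1)) =
        lam (n + 1) := mul_div_cancel₀ _ hL.ne'
    have hs := partialWeight_succ lam n
    have hm := hmean (n + 1)
    rw [Finset.sum_range_succ, ← hmean n] at hm
    have hstep : F (M (n + 1)) = lam (n + 1) / partialWeight lam (n + 1) * F (x (n + 1)) +
        (1 - lam (n + 1) / partialWeight lam (n + 1)) * F (M n) := by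
      refine mul_left_cancel₀ hL.ne' ?_
      linear_combination hm + (F (M n) - F (x (n + 1))) * e - F (M n) * hs
    have := two_point_mean_le hp hη hF hF' hφ (hx (n + 1)) (hM n) (hM (n + 1)) (hηr (n + 1))
      (hr1 (n + 1)) hstep
    have := mul_le_mul_of_nonneg_left this hL.le
    rw [Finset.sum_range_succ _ (n + 1), Finset.sum_range_succ _ (n + 1)]
    generalize hardyC p η ^ p * (1 - η)⁻¹ ^ (p - 1) = K at *
    generalize hardyC p η = C at *
    generalize lam (n + 1) / partialWeight lam (n + 1) = r at *
    have i1 : partialWeight lam (n + 1) * ((r + K) * M (n + 1)) =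
        lam (n + 1) * M (n + 1) + K * (partialWeight lam (n + 1) * M (n + 1)) := by
      linear_combination M (n + 1) * e
    have i2 : partialWeight lam (n + 1) * (C * (r * x (n + 1)) + K * ((1 - r) * M n)) =
        C * (lam (n + 1) * x (n + 1)) + K * (partialWeight lam n * M n) := by
      linear_combination (C * x (n + 1) - K * M n) * e + K * M n * hs
    rw [i1, i2] at this
    linarith

/-! ### Lower bound -/

theorem tendsto_atTop_of_increments {D T : ℕ → ℝ} {δ : ℝ} (hδ : 0 < δ)
    (hT : Tendsto T atTop atTop)
    (h : ∀ᶠ n in atTop, δ * (T (n + 1) - T n) ≤ D (n + 1) - D n) :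
    Tendsto D atTop atTop := by
  obtain ⟨N, hN⟩ := eventually_atTop.1 h
  have hb : ∀ n ≥ N, δ * T n + (D N - δ * T N) ≤ D n := by
    intro n hn
    induction n, hn using Nat.le_induction with
    | base => linarith
    | succ n hn ih => linarith [hN n hn]
  refine tendsto_atTop_mono' atTop (eventually_atTop.2 ⟨N, hb⟩) ?_
  exact tendsto_atTop_add_const_right _ _ (hT.const_mul_atTop hδ)

/-- A version of the Abel–Dini theorem. -/
theorem tendsto_sum_div_partialWeight {lam : ℕ → ℝ} (hlam0 : 0 < lam 0) (hlam : ∀ n, 0 ≤ lam n)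
    (hdiv : Tendsto (partialWeight lam) atTop atTop) {η : ℝ} (hη : η < 1)
    (hlim : Tendsto (fun n => lam n / partialWeight lam n) atTop (𝓝 η)) :
    Tendsto (fun n => ∑ i ∈ Finset.range (n + 1), lam i / partialWeight lam i) atTop atTop := by
  have hpos := partialWeight_pos hlam0 hlam
  refine tendsto_atTop_of_increments (δ := (1 - η) / 2) (by linarith)
    (Real.tendsto_log_atTop.comp hdiv) ?_
  -- Since η < 1, consecutive partial sums are eventually comparable.
  have hr : ∀ᶠ n in atTop, lam (n + 1) / partialWeight lam (n + 1) < (1 + η) / 2 :=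
    ((tendsto_add_atTop_iff_nat 1).2 hlim).eventually_lt_const (by linarith)
  filter_upwards [hr] with n hn
  rw [Finset.sum_range_succ _ (n + 1), add_sub_cancel_left]
  have hs := partialWeight_succ lam n
  have h0 := hpos n
  have h1 := hpos (n + 1)
  have hlog : Real.log (partialWeight lam (n + 1)) - Real.log (partialWeight lam n) ≤
      lam (n + 1) / partialWeight lam n := by
    rw [← Real.log_div h1.ne' h0.ne']
    refine (Real.log_le_sub_one_of_pos (div_pos h1 h0)).trans_eq ?_
    rw [hs]; field_simp; ring
  refine (mul_le_mul_of_nonneg_left hlog (by linarith)).trans ?_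
  rw [div_lt_iff₀ h1] at hn
  rw [mul_div_assoc', div_le_div_iff₀ h0 h1]
  have : (1 - η) / 2 * partialWeight lam (n + 1) ≤ partialWeight lam n := by linarith
  nlinarith [hlam (n + 1)]

/-- The increment of `∑ λᵢ F(1 / Λᵢ) - Λₙ F(c / Λₙ)`, divided by `Λₙ`; here `y = 1 / Λₙ`,
`r = λₙ / Λₙ` and `v = 1 / (1 - r)`. -/
theorem le_increment {F F' : ℝ → ℝ} {p c y r v B τ δ : ℝ} (hp : p < 1)
    (hF : ∀ x, 0 < x → HasDerivAt F (F' x) x) (hF' : 0 < F' 1)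
    (hφ : AntitoneOn (fun x => F' x * x ^ (1 - p)) (Ioi 0))
    (hc1 : 1 < c) (hy : 0 < y) (hr0 : 0 ≤ r) (hr1 : 0 < 1 - r) (hvr : v * (1 - r) = 1)
    (hcv : c * v ≤ B) (hBy1 : B * y ≤ 1)
    (hslow : F' y * y ^ (1 - p) ≤ τ * (F' (B * y) * (B * y) ^ (1 - p))) (hδ0 : 0 < δ)
    (hδ : δ ≤ dslope (powGen p) 1 v + τ * powGen p c⁻¹) :
    F' 1 * c ^ p * δ * (r * y) ≤ r * F y - F (c * y) + (1 - r) * F (c * (v * y)) := by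
  have hc0 : 0 < c := one_pos.trans hc1
  have hv1 : 1 ≤ v := by
    rw [eq_inv_of_mul_eq_one_left hvr]
    exact (one_le_inv₀ hr1).2 (by linarith)
  have hv0 : 0 < v := one_pos.trans_le hv1
  have hcy : 0 < c * y := mul_pos hc0 hy
  have hycy : y ≤ c * y := le_mul_of_one_le_left hy.le hc1.le
  have hcvy : c * y ≤ c * (v * y) :=
    mul_le_mul_of_nonneg_left (le_mul_of_one_le_left hy.le hv1) hc0.le
  have hcvB : c * (v * y) ≤ B * y := by
    rw [← mul_assoc]
    exact mul_le_mul_of_nonneg_right hcv hy.le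
  have hBy0 : 0 < B * y := hcy.trans_le (hcvy.trans hcvB)
  have hk1 : F' 1 ≤ F' (B * y) * (B * y) ^ (1 - p) := by
    have := hφ (mem_Ioi.2 hBy0) (mem_Ioi.2 one_pos) hBy1
    simpa using this
  -- The target is (1-r)(F(cvy) - F(cy)) - r(F(cy) - F(y)); all arguments lie in [y, By], where
  -- F'(u) u^(1-p) varies by at most a factor τ.
  have up : F (c * y) - F y ≤ τ * (F' (B * y) * (B * y) ^ (1 - p)) *
      (powGen p (c * y) - powGen p y) := by
    refine sub_le_mul_powGen_sub hF hy hycy fun u hu => ?_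
    have hu0 : 0 < u := hy.trans_le hu.1
    have := mul_le_mul_of_nonneg_right ((hφ (mem_Ioi.2 hy) (mem_Ioi.2 hu0) hu.1).trans hslow)
      (Real.rpow_nonneg hu0.le (p - 1))
    simpa only [mul_rpow_self_sub_one _ hu0] using this
  have lo : F' (B * y) * (B * y) ^ (1 - p) * (powGen p (c * (v * y)) - powGen p (c * y)) ≤
      F (c * (v * y)) - F (c * y) := by
    refine mul_powGen_sub_le hF hcy hcvy fun u hu => ?_
    have hu0 : 0 < u := hcy.trans_le hu.1
    have := mul_le_mul_of_nonneg_right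
      (hφ (mem_Ioi.2 hu0) (mem_Ioi.2 hBy0) (hu.2.trans hcvB))
      (Real.rpow_nonneg hu0.le (p - 1))
    simpa only [mul_rpow_self_sub_one _ hu0] using this
  have g1 : powGen p (c * (v * y)) - powGen p (c * y) = (c * y) ^ p * powGen p v := by
    rw [powGen_sub (hcy.trans_le hcvy) hcy]
    congr 2
    field_simp
  have g2 : powGen p (c * y) - powGen p y = -((c * y) ^ p * powGen p c⁻¹) := by
    rw [← neg_sub, powGen_sub hy hcy]
    congr 3
    field_simp
  have hyp : y ≤ y ^ p := by
    have := Real.rpow_le_rpow_of_exponent_ge hy (hycy.trans (hcvy.trans (hcvB.trans hBy1)))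
      hp.le
    rwa [Real.rpow_one] at this
  rw [g1, ← sub_one_mul_dslope, Real.mul_rpow hc0.le hy.le] at lo
  rw [g2, Real.mul_rpow hc0.le hy.le] at up
  have hcp := Real.rpow_pos_of_pos hc0 p
  have hyp0 := Real.rpow_pos_of_pos hy p
  generalize F' (B * y) * (B * y) ^ (1 - p) = k at *
  generalize dslope (powGen p) 1 v = R at *
  generalize powGen p c⁻¹ = g at *
  generalize c ^ p = cp at *
  generalize y ^ p = yp at *
  have a1 : F' 1 * y ≤ k * yp := mul_le_mul hk1 hyp hy.le (hF'.le.trans hk1)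
  have a2 : F' 1 * y * δ ≤ k * yp * (R + τ * g) :=
    mul_le_mul a1 hδ hδ0.le (mul_nonneg (hF'.le.trans hk1) hyp0.le)
  have a3 := mul_le_mul_of_nonneg_left a2 (mul_nonneg hr0 hcp.le)
  have up' := mul_le_mul_of_nonneg_left up hr0
  have lo' := mul_le_mul_of_nonneg_left lo hr1.le
  -- (1-r)(v-1) = r gives both differences the common factor r.
  have i1 : (1 - r) * (k * (cp * yp * ((v - 1) * R))) = r * (k * (cp * yp) * R) := by
    linear_combination k * (cp * yp) * R * hvr
  rw [i1] at lo'
  linarith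

/-- The means of the sequence `1 / Λₙ` are asymptotically at least `c / Λₙ` for every
`c < hardyC p η`. -/
theorem eventually_le_mean {lam : ℕ → ℝ} (hlam0 : 0 < lam 0) (hlam : ∀ n, 0 ≤ lam n)
    (hdiv : Tendsto (partialWeight lam) atTop atTop)
    {F F' : ℝ → ℝ} {p η : ℝ} (hp : p < 1) (hη : η ∈ Ico (0 : ℝ) 1)
    (hlim : Tendsto (fun n => lam n / partialWeight lam n) atTop (𝓝 η))
    (hF : ∀ x, 0 < x → HasDerivAt F (F' x) x) (hF' : ∀ x, 0 < x → 0 < F' x)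
    (hφ : AntitoneOn (fun x => F' x * x ^ (1 - p)) (Ioi 0))
    (hslow : ∀ B τ : ℝ, 1 < B → 1 < τ →
      ∀ᶠ y in 𝓝[>] 0, F' y * y ^ (1 - p) ≤ τ * (F' (B * y) * (B * y) ^ (1 - p)))
    {M : ℕ → ℝ} (hM : ∀ n, 0 < M n)
    (hmean : ∀ n, partialWeight lam n * F (M n) =
      ∑ i ∈ Finset.range (n + 1), lam i * F (partialWeight lam i)⁻¹)
    {c : ℝ} (hc1 : 1 < c) (hc : c < hardyC p η) :
    ∀ᶠ n in atTop, c / partialWeight lam n ≤ M n := by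
  have hpos := partialWeight_pos hlam0 hlam
  have hc0 : 0 < c := one_pos.trans hc1
  have hη1 : 0 < 1 - η := by linarith [hη.2]
  set R := dslope (powGen p) 1 with hR
  set v : ℝ → ℝ := fun r => (1 - r)⁻¹ with hv
  have hgc : -R (v η) < powGen p c⁻¹ := by
    rw [← powGen_inv_hardyC hp hη]
    exact powGen_lt_powGen (inv_pos.2 (hc0.trans hc)) (inv_strictAnti₀ hc0 hc)
  have hgc0 : powGen p c⁻¹ < 0 := by
    rw [← powGen_one p]
    exact powGen_lt_powGen (inv_pos.2 hc0) (inv_lt_one_of_one_lt₀ hc1)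
  -- Since c < C, the inequality is strict at τ = 1 and survives for τ slightly larger.
  obtain ⟨τ, hτ1, hτ⟩ : ∃ τ : ℝ, 1 < τ ∧ 0 < R (v η) + τ * powGen p c⁻¹ := by
    have hcont : ContinuousAt (fun τ => R (v η) + τ * powGen p c⁻¹) 1 := by fun_prop
    have := hcont.eventually_const_lt (u := 0) (by linarith)
    obtain ⟨τ, h1, h2⟩ := (Filter.Eventually.and (nhdsWithin_le_nhds (s := Ioi 1) this)
      (self_mem_nhdsWithin (s := Ioi 1))).exists
    exact ⟨τ, h2, h1⟩
  obtain ⟨δ, hδ0, hδ⟩ := exists_between hτ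
  set B : ℝ := c * (v η + 1) with hB
  have hvη : 0 < v η := inv_pos.2 hη1
  have hB1 : 1 < B := by nlinarith
  have hlim1 := (tendsto_add_atTop_iff_nat 1).2 hlim
  have hvlim : Tendsto (fun n => v (lam (n + 1) / partialWeight lam (n + 1))) atTop
      (𝓝 (v η)) := (hlim1.const_sub 1).inv₀ hη1.ne'
  have hRlim := ((continuousAt_dslope_powGen p hvη).tendsto.comp hvlim).add_const
    (τ * powGen p c⁻¹)
  have hylim : Tendsto (fun n => (partialWeight lam (n + 1))⁻¹) atTop (𝓝[>] 0) :=
    tendsto_inv_atTop_nhdsGT_zero.comp ((tendsto_add_atTop_iff_nat 1).2 hdiv)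
  have hφ1 : 0 < F' 1 := hF' 1 one_pos
  have hBy : ∀ᶠ y : ℝ in 𝓝[>] 0, y < B⁻¹ :=
    nhdsWithin_le_nhds (gt_mem_nhds (inv_pos.2 (one_pos.trans hB1)))
  have hD : Tendsto (fun n => ∑ i ∈ Finset.range (n + 1), lam i * F (partialWeight lam i)⁻¹ -
      partialWeight lam n * F (c * (partialWeight lam n)⁻¹)) atTop atTop := by
    refine tendsto_atTop_of_increments (δ := F' 1 * c ^ p * δ)
      (by have := Real.rpow_pos_of_pos hc0 p; positivity)
      (tendsto_sum_div_partialWeight hlam0 hlam hdiv hη.2 hlim) ?_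
    filter_upwards [hvlim.eventually_lt_const (lt_add_one (v η)),
      hRlim.eventually_const_lt hδ, hylim.eventually (hslow B τ hB1 hτ1),
      hylim.eventually hBy] with n h1 h2 h3 h4
    rw [Finset.sum_range_succ _ (n + 1), add_sub_cancel_left, Finset.sum_range_succ _ (n + 1)]
    simp only [Function.comp] at h2
    have hL1 := hpos (n + 1)
    have hL0 := hpos n
    have hs := partialWeight_succ lam n
    set Λ := partialWeight lam (n + 1) with hΛ
    set r := lam (n + 1) / Λ with hr
    have hlr : lam (n + 1) = Λ * r := (mul_div_cancel₀ _ hL1.ne').symm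
    have hL0r : partialWeight lam n = Λ * (1 - r) := by linarith
    have hr1 : 0 < 1 - r := by
      rw [hL0r] at hL0
      exact pos_of_mul_pos_right hL0 hL1.le
    have hr0 : 0 ≤ r := div_nonneg (hlam _) hL1.le
    have hvr : v r * (1 - r) = 1 := inv_mul_cancel₀ hr1.ne'
    have hinv : (partialWeight lam n)⁻¹ = v r * Λ⁻¹ := by
      rw [hL0r, mul_inv, mul_comm]
    rw [hinv, hL0r, hlr]
    have hy : 0 < Λ⁻¹ := inv_pos.2 hL1
    have hyΛ : Λ * Λ⁻¹ = 1 := mul_inv_cancel₀ hL1.ne'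
    set y := Λ⁻¹ with hydef
    have hBy1 : B * y ≤ 1 := by
      have := mul_le_mul_of_nonneg_left h4.le (one_pos.trans hB1).le
      rwa [mul_inv_cancel₀ (one_pos.trans hB1).ne'] at this
    have fin := le_increment hp hF hφ1 hφ hc1 hy hr0 hr1 hvr
      (mul_le_mul_of_nonneg_left h1.le hc0.le) hBy1 h3 hδ0 h2.le
    have fin' := mul_le_mul_of_nonneg_left fin hL1.le
    have i2 : Λ * (F' 1 * c ^ p * δ * (r * y)) = F' 1 * c ^ p * δ * r := by
      linear_combination F' 1 * c ^ p * δ * r * hyΛ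
    rw [i2] at fin'
    linarith
  have hmono : StrictMonoOn F (Ioi 0) := by
    refine strictMonoOn_of_deriv_pos (convex_Ioi 0)
      (fun x hx => (hF x hx).continuousAt.continuousWithinAt) fun x hx => ?_
    rw [interior_Ioi] at hx
    rw [(hF x hx).deriv]
    exact hF' x hx
  filter_upwards [hD.eventually_ge_atTop 0] with n hn
  rw [← hmean n, ← mul_sub, ← div_eq_mul_inv] at hn
  have := nonneg_of_mul_nonneg_right hn (hpos n)
  exact (hmono.le_iff_le (mem_Ioi.2 (div_pos hc0 (hpos n))) (mem_Ioi.2 (hM n))).1 (by linarith)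

/-! ### Consequences of the hypotheses on χ_f -/

theorem hasDerivAt_mul_rpow {G G' : ℝ → ℝ} (a : ℝ) {x : ℝ} (hx : 0 < x)
    (hG : HasDerivAt G (G' x) x) (hGx : G x ≠ 0) :
    HasDerivAt (fun x => G x * x ^ a) (G x * x ^ (a - 1) * (x * G' x / G x + a)) x := by
  refine (hG.mul (Real.hasDerivAt_rpow_const (p := a) (Or.inl hx.ne'))).congr_deriv ?_
  have : x ^ a = x ^ (a - 1) * x := by rw [Real.rpow_sub_one hx.ne']; field_simp
  rw [this]
  field_simp

/-- The logarithmic derivative is (χ - p)/x, where χ = x G'/G + 1. -/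
theorem antitoneOn_mul_rpow {G G' : ℝ → ℝ} {p : ℝ}
    (hG : ∀ x, 0 < x → HasDerivAt G (G' x) x) (hpos : ∀ x, 0 < x → 0 < G x)
    (hchi : ∀ x, 0 < x → x * G' x / G x + 1 ≤ p) :
    AntitoneOn (fun x => G x * x ^ (1 - p)) (Ioi 0) := by
  have hd := fun x (hx : 0 < x) => hasDerivAt_mul_rpow (1 - p) hx (hG x hx) (hpos x hx).ne'
  refine antitoneOn_of_deriv_nonpos (convex_Ioi 0)
    (fun x hx => (hd x hx).continuousAt.continuousWithinAt)
    (fun x hx => (hd x (interior_subset hx)).differentiableAt.differentiableWithinAt) ?_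
  intro x hx
  have hx0 : 0 < x := interior_subset hx
  rw [(hd x hx0).deriv]
  exact mul_nonpos_of_nonneg_of_nonpos
    (mul_pos (hpos x hx0) (Real.rpow_pos_of_pos hx0 _)).le (by linarith [hchi x hx0])

/-- If `x G'(x) / G(x) + 1 → p` at `0` then `G(x) x ^ (1 - p)` varies slowly at `0`. -/
theorem eventually_mul_rpow_le {G G' : ℝ → ℝ} {p : ℝ}
    (hG : ∀ x, 0 < x → HasDerivAt G (G' x) x) (hpos : ∀ x, 0 < x → 0 < G x)
    (hlim : Tendsto (fun x => x * G' x / G x + 1) (𝓝[>] 0) (𝓝 p))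
    {B τ : ℝ} (hB : 1 < B) (hτ : 1 < τ) :
    ∀ᶠ y in 𝓝[>] 0, G y * y ^ (1 - p) ≤ τ * (G (B * y) * (B * y) ^ (1 - p)) := by
  have hB0 : 0 < B := one_pos.trans hB
  obtain ⟨δ, hδ, hBδ⟩ : ∃ δ : ℝ, 0 < δ ∧ B ^ δ = τ := by
    refine ⟨Real.log τ / Real.log B, div_pos (Real.log_pos hτ) (Real.log_pos hB), ?_⟩
    rw [Real.rpow_def_of_pos hB0, mul_div_cancel₀ _ (Real.log_pos hB).ne',
      Real.exp_log (one_pos.trans hτ)]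
  obtain ⟨ε, hε, hchi⟩ := mem_nhdsGT_iff_exists_Ioo_subset.1
    (hlim.eventually_const_lt (sub_lt_self p hδ))
  have hε : 0 < ε := hε
  have hd := fun x (hx : 0 < x) =>
    hasDerivAt_mul_rpow (1 - p + δ) hx (hG x hx) (hpos x hx).ne'
  -- Where χ > p - δ, the extra factor x^δ makes the product monotone; its cost over a ratio B is
  -- B^δ = τ.
  have hm : MonotoneOn (fun x => G x * x ^ (1 - p + δ)) (Ioo 0 ε) := by
    refine monotoneOn_of_deriv_nonneg (convex_Ioo 0 ε)
      (fun x hx => (hd x hx.1).continuousAt.continuousWithinAt)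
      (fun x hx => (hd x (interior_subset hx).1).differentiableAt.differentiableWithinAt) ?_
    intro x hx
    have hx' := interior_subset hx
    have hlt : p - δ < x * G' x / G x + 1 := hchi hx'
    rw [(hd x hx'.1).deriv]
    exact mul_nonneg
      (mul_pos (hpos x hx'.1) (Real.rpow_pos_of_pos hx'.1 _)).le (by linarith)
  filter_upwards [Ioo_mem_nhdsGT (div_pos hε hB0)] with y hy
  have hy0 : 0 < y := hy.1
  have hBy : B * y < ε := by have := (lt_div_iff₀ hB0).1 hy.2; linarith
  have hyB : y ≤ B * y := by nlinarith
  have h := hm ⟨hy0, hyB.trans_lt hBy⟩ ⟨mul_pos hB0 hy0, hBy⟩ hyB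
  simp only [Real.rpow_add hy0, Real.rpow_add (mul_pos hB0 hy0)] at h
  rw [Real.mul_rpow (z := δ) hB0.le hy0.le, hBδ] at h
  refine le_of_mul_le_mul_right ?_ (Real.rpow_pos_of_pos hy0 δ)
  linarith

/-! ### The mean and the main theorem -/

theorem quasiArithmeticMean_spec {I : Set ℝ} {f : ℝ → ℝ} (hI : I.OrdConnected)
    (hf : ContinuousOn f I) {n : ℕ} {x w : Fin n → ℝ} (hx : ∀ i, x i ∈ I) (hw : ∀ i, 0 ≤ w i)
    (hw' : 0 < ∑ i, w i) :
    quasiArithmeticMean I f n x w ∈ I ∧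
      (∑ i, w i) * f (quasiArithmeticMean I f n x w) = ∑ i, w i * f (x i) := by
  have hconv : Convex ℝ (f '' I) :=
    ((hI.isPreconnected.image f hf).ordConnected).convex
  have hmem : (∑ i, w i * f (x i)) / ∑ i, w i ∈ f '' I := by
    have := hconv.centerMass_mem (t := Finset.univ) (fun i _ => hw i) hw'
      (fun i _ => mem_image_of_mem f (hx i))
    simpa [Finset.centerMass, div_eq_inv_mul] using this
  refine ⟨Function.invFunOn_mem hmem, ?_⟩
  rw [quasiArithmeticMean, Function.invFunOn_eq hmem, mul_div_cancel₀ _ hw'.ne']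

theorem mainTheorem4
    (lam : ℕ → ℝ) (hlam0 : 0 < lam 0) (hlam : ∀ n, 0 ≤ lam n)
    (hdiv : Tendsto (partialWeight lam) atTop atTop)
    (hanti : Antitone (fun n => lam n / partialWeight lam n))
    (η : ℝ) (hη : η ∈ Set.Ico (0 : ℝ) 1)
    (hlim : Tendsto (fun n => lam n / partialWeight lam n) atTop (𝓝 η))
    (f : ℝ → ℝ) (hf : ContDiffOn ℝ 2 f (Set.Ioi 0))
    (hf' : ∀ x : ℝ, 0 < x → deriv f x ≠ 0)
    (p : ℝ) (hp : Tendsto (chi f) (𝓝[>] 0) (𝓝 p)) (hp1 : p < 1)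
    (hchi : ∀ x : ℝ, 0 < x → chi f x ≤ p) :
    IsHardyConstant (Set.Ioi 0) (quasiArithmeticMean (Set.Ioi 0) f) lam
      (ENNReal.ofReal (hardyC p η)) := by
  have hd1 : ∀ x, 0 < x → HasDerivAt f (deriv f x) x := fun x hx =>
    ((hf.differentiableOn (by norm_num)).differentiableAt (Ioi_mem_nhds hx)).hasDerivAt
  have hd2 : ∀ x, 0 < x → HasDerivAt (deriv f) (deriv (deriv f) x) x := fun x hx =>
    (((hf.deriv_of_isOpen (m := 1) isOpen_Ioi (by norm_num)).differentiableOn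
      (by norm_num)).differentiableAt (Ioi_mem_nhds hx)).hasDerivAt
  -- By Darboux, f' has constant sign; scaling f by s preserves χ_f and the mean equation.
  obtain ⟨s, hs0, hs⟩ : ∃ s : ℝ, s ≠ 0 ∧ ∀ x, 0 < x → 0 < s * deriv f x := by
    rcases hasDerivWithinAt_forall_lt_or_forall_gt_of_forall_ne (convex_Ioi (0 : ℝ))
      (fun x hx => (hd1 x hx).hasDerivWithinAt) hf' with h | h
    · exact ⟨-1, by norm_num, fun x hx => by linarith [h x hx]⟩
    · exact ⟨1, one_ne_zero, fun x hx => by linarith [h x hx]⟩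
  have hF : ∀ x, 0 < x → HasDerivAt (fun x => s * f x) (s * deriv f x) x :=
    fun x hx => (hd1 x hx).const_mul s
  have hG : ∀ x, 0 < x → HasDerivAt (fun x => s * deriv f x) (s * deriv (deriv f) x) x :=
    fun x hx => (hd2 x hx).const_mul s
  have hchi_eq : ∀ x, x * (s * deriv (deriv f) x) / (s * deriv f x) + 1 = chi f x := by
    intro x
    rw [chi, mul_left_comm, mul_div_mul_left _ _ hs0]
  have hφ := antitoneOn_mul_rpow hG hs (fun x hx => (hchi_eq x).trans_le (hchi x hx))
  have hslow := fun (B τ : ℝ) (hB : 1 < B) (hτ : 1 < τ) =>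
    eventually_mul_rpow_le hG hs (hp.congr fun x => (hchi_eq x).symm) hB hτ
  have hpos := partialWeight_pos hlam0 hlam
  set M : (ℕ → ℝ) → ℕ → ℝ := fun x n => quasiArithmeticMean (Ioi 0) f (n + 1)
    (fun i : Fin (n + 1) => x i) (fun i : Fin (n + 1) => lam i) with hMdef
  have hM : ∀ x : ℕ → ℝ, (∀ n, 0 < x n) → ∀ n, 0 < M x n ∧
      partialWeight lam n * (s * f (M x n)) =
        ∑ i ∈ Finset.range (n + 1), lam i * (s * f (x i)) := by
    intro x hx n
    have hsum : ∑ i : Fin (n + 1), lam i = partialWeight lam n :=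
      (Finset.sum_range lam).symm
    obtain ⟨h1, h2⟩ := quasiArithmeticMean_spec (f := f) (n := n + 1)
      (x := fun i : Fin (n + 1) => x i) (w := fun i : Fin (n + 1) => lam i) ordConnected_Ioi
      (fun x hx => (hd1 x hx).continuousAt.continuousWithinAt) (fun i => hx i)
      (fun i => hlam i) (hsum ▸ hpos n)
    refine ⟨h1, ?_⟩
    rw [hsum, ← Finset.sum_range (fun i => lam i * f (x i))] at h2
    rw [mul_left_comm, h2, Finset.mul_sum]
    exact Finset.sum_congr rfl fun i _ => by ring
  have hC := hardyC_pos hp1 hη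
  refine ⟨fun x hx => ENNReal.tsum_le_of_sum_range_le fun n => ?_, fun H hH => ?_⟩
  · rcases n with _ | n
    · simp
    have hfin := sum_mean_add_le hlam0 hlam hp1 hη (hanti.le_of_tendsto hlim) hF hs hφ hx
      (fun n => (hM x hx n).1) (fun n => (hM x hx n).2) n
    have hrem : 0 ≤ hardyC p η ^ p * (1 - η)⁻¹ ^ (p - 1) *
        (partialWeight lam n * M x n) := by
      have h1 : 0 < 1 - η := by linarith [hη.2]
      have := (hM x hx n).1
      have := hpos n
      positivity
    have hxn : ∀ i, 0 ≤ lam i * x i := fun i => mul_nonneg (hlam i) (le_of_lt (hx i))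
    calc ∑ i ∈ Finset.range (n + 1), ENNReal.ofReal (lam i * M x i)
        = ENNReal.ofReal (∑ i ∈ Finset.range (n + 1), lam i * M x i) :=
          (ENNReal.ofReal_sum_of_nonneg fun i _ =>
            mul_nonneg (hlam i) (hM x hx i).1.le).symm
      _ ≤ ENNReal.ofReal (hardyC p η * ∑ i ∈ Finset.range (n + 1), lam i * x i) :=
          ENNReal.ofReal_le_ofReal (by linarith)
      _ = ENNReal.ofReal (hardyC p η) *
            ∑ i ∈ Finset.range (n + 1), ENNReal.ofReal (lam i * x i) := by
          rw [ENNReal.ofReal_mul hC.le, ENNReal.ofReal_sum_of_nonneg fun i _ => hxn i]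
      _ ≤ _ := by gcongr; exact ENNReal.sum_le_tsum _
  · by_contra hlt
    push Not at hlt
    have hHfin : H ≠ ⊤ := (hlt.trans ENNReal.ofReal_lt_top).ne
    have hh : H.toReal < hardyC p η := (ENNReal.lt_ofReal_iff_toReal_lt hHfin).1 hlt
    obtain ⟨c, hc, hcC⟩ := exists_between (max_lt (one_lt_hardyC hp1 hη) hh)
    obtain ⟨hc1, hch⟩ := max_lt_iff.1 hc
    set u : ℕ → ℝ := fun n => (partialWeight lam n)⁻¹ with hu
    have hu0 : ∀ n, 0 < u n := fun n => inv_pos.2 (hpos n)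
    have hev := eventually_le_mean hlam0 hlam hdiv hp1 hη hlim hF hs hφ hslow
      (fun n => (hM u hu0 n).1) (fun n => (hM u hu0 n).2) hc1 hcC
    have hS := tendsto_sum_div_partialWeight hlam0 hlam hdiv hη.2 hlim
    have hD : Tendsto (fun n => ∑ i ∈ Finset.range (n + 1), lam i * M u i -
        H.toReal * ∑ i ∈ Finset.range (n + 1), lam i / partialWeight lam i) atTop atTop := by
      refine tendsto_atTop_of_increments (sub_pos.2 hch) hS ?_
      filter_upwards [(tendsto_add_atTop_nat 1).eventually hev] with n hn
      rw [Finset.sum_range_succ _ (n + 1), Finset.sum_range_succ _ (n + 1)]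
      have := mul_le_mul_of_nonneg_left hn (hlam (n + 1))
      have e : lam (n + 1) * (c / partialWeight lam (n + 1)) =
          c * (lam (n + 1) / partialWeight lam (n + 1)) := by ring
      rw [e] at this
      linarith
    -- A gap above H absorbs the tail added below, whose weighted sum is at most 1.
    obtain ⟨N, hN⟩ := (hD.eventually_gt_atTop H.toReal).exists
    -- The denominator `lam n + 1` is positive even when the weight vanishes.
    set x : ℕ → ℝ := fun n => if n ≤ N then u n else (1 / 2 / 2 ^ n) / (lam n + 1) with hx
    have hx0 : ∀ n, 0 < x n := by
      intro n
      have := hu0 n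
      have := hlam n
      simp only [hx]
      split_ifs <;> positivity
    have hMx : ∀ n ≤ N, M x n = M u n := by
      intro n hn
      simp only [hMdef]
      congr 1
      funext i
      simp only [hx, (Nat.lt_succ_iff.1 i.2).trans hn, if_true]
    have hle := hH x hx0
    have hlow : ENNReal.ofReal (∑ i ∈ Finset.range (N + 1), lam i * M u i) ≤
        ∑' n, ENNReal.ofReal (lam n * M x n) := by
      rw [ENNReal.ofReal_sum_of_nonneg fun i _ => mul_nonneg (hlam i) (hM u hu0 i).1.le]
      refine le_trans (le_of_eq (Finset.sum_congr rfl fun i hi => ?_))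
        (ENNReal.sum_le_tsum (Finset.range (N + 1)))
      rw [hMx i (Nat.lt_succ_iff.1 (Finset.mem_range.1 hi))]
    have hup : ∑' n, ENNReal.ofReal (lam n * x n) ≤
        ENNReal.ofReal (∑ i ∈ Finset.range (N + 1), lam i / partialWeight lam i + 1) := by
      have hq : ∀ i, 0 ≤ lam i / partialWeight lam i := fun i =>
        div_nonneg (hlam i) (hpos i).le
      refine ENNReal.tsum_le_of_sum_range_le fun n => ?_
      rw [← ENNReal.ofReal_sum_of_nonneg fun i _ => mul_nonneg (hlam i) (hx0 i).le]
      refine ENNReal.ofReal_le_ofReal ?_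
      have hterm : ∀ i, lam i * x i ≤
          (if i ∈ Finset.range (N + 1) then lam i / partialWeight lam i else 0) +
            1 / 2 / 2 ^ i := by
        intro i
        have hg : (0 : ℝ) < 1 / 2 / 2 ^ i := by positivity
        by_cases hi : i ≤ N
        · simp only [hx, hi, if_true, Finset.mem_range, Nat.lt_succ_iff, hu, div_eq_mul_inv]
            at hg ⊢
          linarith
        · simp only [hx, hi, if_false, Finset.mem_range, Nat.lt_succ_iff, zero_add]
          have := hlam i
          rw [mul_div_assoc', div_le_iff₀ (by linarith)]
          nlinarith
      refine (Finset.sum_le_sum fun i _ => hterm i).trans ?_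
      rw [Finset.sum_add_distrib]
      refine add_le_add ?_ ?_
      · rw [← Finset.sum_filter]
        refine Finset.sum_le_sum_of_subset_of_nonneg (fun i hi => (Finset.mem_filter.1 hi).2)
          fun i _ _ => hq i
      · exact ((summable_geometric_two' 1).sum_le_tsum _ fun i _ => by positivity).trans_eq
          (tsum_geometric_two' 1)
    have hfinal := (hlow.trans hle).trans (mul_le_mul_right hup H)
    rw [← ENNReal.ofReal_toReal hHfin, ← ENNReal.ofReal_mul ENNReal.toReal_nonneg,
      ENNReal.ofReal_le_ofReal_iff] at hfinal
    · linarith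
    · refine mul_nonneg ENNReal.toReal_nonneg
        (add_nonneg (Finset.sum_nonneg fun i _ => ?_) one_pos.le)
      exact div_nonneg (hlam i) (hpos i).le
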